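/- All algebras are complex. For a Banach algebra $A$ (with or without unit) let $K(A)$ be the set of its compact elements, i.e. of those $a\in A$ for which the operator $A\to A$, $x\mapsto axa$, is compact. A uniform algebra is a commutative Banach algebra (with or without unit) such that $\|a^2\|=\|a\|^2$ for all $a$. Let $B(\ell_2)$ and $K(\ell_2)$ denote the bounded and the compact operators on $\ell_2=\ell_2(\mathbb N)$, and let $M(A)$ denote the multiplier algebra (the algebra of double centralizers) of a C$^*$-algebra $A$. **Corollary.** Let $X$ satisfy at least one of the following conditions: 1. $X$ is a separable uniform algebra or a separable abelian C$^*$-algebra, and $K(X)=\{0\}$; 2. $X=M(A)$, where $A$ is a separable non-unital C$^*$-algebra (not necessarily commutative) with no non-zero compact elements, i.e. $K(A)=\{0\}$. Then there is an isometric and isomorphic copy of $X$ inside $(B(\ell_2)\setminus K(\ell_2))\cup\{0\}$. That is, there is an isometric (complex-linear, multiplicative) algebra homomorphism $\varphi:X\to B(\ell_2)$ with $\varphi(X)\subseteq (B(\ell_2)\setminus K(\ell_2))\cup\{0\}$; when $X$ is a C$^*$-algebra (the abelian C$^*$-algebra case of (1), and case (2)), $\varphi$ can be taken to be a $^*$-homomorphism.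 Moreover, the diagonal map $\Phi:\ell_\infty\to B(\ell_2)$, $(\Phi(f)g)(n)=f(n)g(n)$, is an isometric unital $^*$-homomorphism, and $\Phi(c_0)=K(\ell_2)\cap\Phi(\ell_\infty)$. -/

import Mathlib

open scoped MultiplierAlgebra ENNReal Topology

/-- `K(A)`: the compact elements of a normed algebra `A`, i.e. those `a` for which the operator
`U_a : A → A, x ↦ a x a` is compact. -/
def compactElements (A : Type*) [NonUnitalNormedRing A] : Set A :=
  {a | IsCompactOperator (fun x : A => a * x * a)}

/-- A commutative complex Banach algebra (with or without a unit) is a uniform algebra when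
`‖a ^ 2‖ = ‖a‖ ^ 2` for all `a`, equivalently when its Gelfand transform is isometric. -/
def IsUniformAlgebra (A : Type*) [NonUnitalNormedCommRing A] [NormedSpace ℂ A]
    [IsScalarTower ℂ A A] [SMulCommClass ℂ A A] [CompleteSpace A] : Prop :=
  ∀ a : A, ‖a * a‖ = ‖a‖ ^ 2

/-- `A` has a two-sided multiplicative identity. (The zero algebra has one.) -/
def HasUnit (A : Type*) [NonUnitalNormedRing A] : Prop :=
  ∃ e : A, ∀ a : A, e * a = a ∧ a * e = a

/-- The complex Hilbert space `ℓ₂(ℕ)`. -/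
abbrev EllTwo : Type := lp (fun _ : ℕ => ℂ) 2

/-- The C⋆-algebra `ℓ∞` of bounded complex sequences. -/
abbrev EllInfty : Type := lp (fun _ : ℕ => ℂ) ∞

/-- `c₀`, as a subset of `ℓ∞`. -/
def cZero : Set EllInfty :=
  {f | Filter.Tendsto (fun n : ℕ => f n) Filter.atTop (𝓝 0)}

/-- `B(ℓ₂)`, the bounded operators on `ℓ₂(ℕ)`. -/
abbrev BoundedOps : Type := EllTwo →L[ℂ] EllTwo

/-- `K(ℓ₂)`, the compact operators on `ℓ₂(ℕ)`. -/
def compactOps : Set BoundedOps :=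
  {T | IsCompactOperator (T : EllTwo → EllTwo)}

/-! Compact operators are avoided by infinite repetition.

For a uniform algebra, `‖a * a‖ = ‖a‖ ^ 2` makes the spectral radius equal to the norm, so every
element is normed by a contractive character. Characters norming a dense sequence give an isometric
homomorphism into `ℓ∞`. Each one is listed infinitely often, so an image tends to zero only if it
vanishes; and a diagonal operator is compact exactly when its symbol lies in `c₀`.

For a separable C⋆-algebra, a weighted sum of norming states is a faithful positive functional. Its
GNS space is separable and carries a faithful representation of the multiplier algebra. The
ampliation `T ⊗ 1` is compact only for `T = 0`, and an isometry of Hilbert spaces moves everything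
into `ℓ₂`. Injective ⋆-homomorphisms are isometric. The algebra itself sits inside its multiplier
algebra. -/

/-- A compact operator cannot send a bounded sequence to a uniformly separated one. -/
theorem not_isCompactOperator_of_separated {E F : Type*} [NormedAddCommGroup E] [NormedSpace ℂ E]
    [NormedAddCommGroup F] [NormedSpace ℂ F] (T : E →L[ℂ] F) (x : ℕ → E) {C ε : ℝ}
    (hx : ∀ n, ‖x n‖ ≤ C) (hε : 0 < ε)
    (hT : ∀ m n, m < n → ε ≤ dist (T (x m)) (T (x n))) : ¬ IsCompactOperator (T : E → F) := by
  intro hc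
  obtain ⟨K, hK, hsub⟩ := IsCompactOperator.image_closedBall_subset_compact (f := (T : E →ₗ[ℂ] F))
    hc C
  have hmem : ∀ n, T (x n) ∈ K := fun n => hsub ⟨x n, by simpa using hx n, rfl⟩
  obtain ⟨a, -, u, hu, hlim⟩ := hK.tendsto_subseq hmem
  obtain ⟨N, hN⟩ := (Metric.cauchySeq_iff.1 hlim.cauchySeq) ε hε
  exact absurd (hN N le_rfl (N + 1) (Nat.le_succ N)) (not_lt.2 (hT _ _ (hu (Nat.lt_succ_self N))))

theorem lp_single_dist_ge {H : Type*} [NormedAddCommGroup H] {i j : ℕ} (hij : i ≠ j) (a b : H) :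
    ‖a‖ ≤ dist (lp.single (E := fun _ : ℕ => H) 2 i a) (lp.single 2 j b) := by
  rw [dist_eq_norm]
  have := lp.norm_apply_le_norm (p := 2) (by norm_num)
    (lp.single (E := fun _ : ℕ => H) 2 i a - lp.single 2 j b) i
  rwa [lp.coeFn_sub, Pi.sub_apply, lp.single_apply_self, lp.single_apply_ne _ _ _ hij,
    sub_zero] at this

/-! ### Diagonal operators and `c₀`. -/

/-- The multiplication operator on `ℓ₂` with symbol `f`. -/
noncomputable def diagonalOp (f : EllInfty) : BoundedOps :=
  lp.mapCLM 2 (fun n => f n • ContinuousLinearMap.id ℂ ℂ) (norm_nonneg f) fun n => by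
    rw [norm_smul, ContinuousLinearMap.norm_id, mul_one]
    exact lp.norm_apply_le_norm (by simp) f n

@[simp]
theorem diagonalOp_apply (f : EllInfty) (g : EllTwo) (n : ℕ) : diagonalOp f g n = f n * g n := by
  simp [diagonalOp]

theorem boundedOps_ext {S T : BoundedOps} (h : ∀ g n, S g n = T g n) : S = T :=
  ContinuousLinearMap.ext fun g => lp.ext (funext (h g))

/-- The diagonal embedding of `ℓ∞` into `B(ℓ₂)`. -/
noncomputable def diagonalHom : EllInfty →⋆ₐ[ℂ] BoundedOps where
  toFun := diagonalOp
  map_one' := boundedOps_ext fun g n => by simp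
  map_zero' := boundedOps_ext fun g n => by simp
  map_mul' a b := boundedOps_ext fun g n => by simp [mul_assoc]
  map_add' a b := boundedOps_ext fun g n => by simp [add_mul]
  commutes' r := boundedOps_ext fun g n => by
    simp [Algebra.algebraMap_eq_smul_one]
  map_star' a := by
    rw [ContinuousLinearMap.star_eq_adjoint, ContinuousLinearMap.eq_adjoint_iff]
    intro x y
    rw [lp.inner_eq_tsum, lp.inner_eq_tsum]
    refine tsum_congr fun n => ?_
    simp
    ring

@[simp]
theorem diagonalHom_apply (f : EllInfty) (g : EllTwo) (n : ℕ) :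
    diagonalHom f g n = f n * g n := diagonalOp_apply f g n

theorem diagonalHom_single (f : EllInfty) (n : ℕ) (c : ℂ) :
    diagonalHom f (lp.single 2 n c) = lp.single 2 n (f n * c) := by
  refine lp.ext (funext fun k => ?_)
  rcases eq_or_ne k n with rfl | h
  · simp
  · rw [diagonalHom_apply, lp.single_apply_ne _ _ _ h, lp.single_apply_ne _ _ _ h, mul_zero]

theorem diagonalHom_injective : Function.Injective diagonalHom := by
  intro f g h
  refine lp.ext (funext fun n => ?_)
  have := congrArg (fun T : BoundedOps => T (lp.single 2 n 1) n) h
  simpa using this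

theorem diagonalHom_isometry : Isometry diagonalHom :=
  NonUnitalStarAlgHom.isometry diagonalHom diagonalHom_injective

/-- A diagonal operator whose symbol does not tend to zero is not compact. -/
theorem mem_cZero_of_isCompactOperator {f : EllInfty} (hf : diagonalHom f ∈ compactOps) :
    f ∈ cZero := by
  by_contra h
  have h' : ∃ ε > 0, ∃ᶠ n in Filter.atTop, ε ≤ ‖f n‖ := by
    by_contra! hn
    refine h (Metric.tendsto_nhds.2 fun ε hε => ?_)
    simpa [Filter.not_frequently] using hn ε hε
  obtain ⟨ε, hε, hfr⟩ := h'
  obtain ⟨u, hu, hfu⟩ := Filter.extraction_of_frequently_atTop hfr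
  -- Basis vectors along a subsequence where `|f| ≥ ε` have `ε`-separated images.
  refine not_isCompactOperator_of_separated (diagonalHom f) (fun k => lp.single 2 (u k) 1) (C := 1)
    (fun k => by rw [lp.norm_single (by norm_num)]; simp) hε (fun m n hmn => ?_) hf
  rw [diagonalHom_single, diagonalHom_single, mul_one, mul_one]
  exact (hfu m).trans (lp_single_dist_ge (hu hmn).ne _ _)

theorem isCompactOperator_single (n : ℕ) (c : ℂ) :
    diagonalHom (lp.single ∞ n c) ∈ compactOps := by
  have : (diagonalHom (lp.single ∞ n c) : BoundedOps) =
      ((lp.singleContinuousLinearMap ℂ (fun _ : ℕ => ℂ) 2 n).comp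
        (c • ContinuousLinearMap.id ℂ ℂ)).comp (lp.evalCLM ℂ (fun _ : ℕ => ℂ) 2 n) := by
    refine boundedOps_ext fun g k => ?_
    have he : lp.evalCLM ℂ (fun _ : ℕ => ℂ) 2 n g = g n := rfl
    rcases eq_or_ne k n with rfl | h
    · simp [he]
    · simp [h]
  rw [this]
  exact (isCompactOperator_of_locallyCompactSpace_rng
    ((lp.singleContinuousLinearMap ℂ (fun _ : ℕ => ℂ) 2 n).comp
      (c • ContinuousLinearMap.id ℂ ℂ))).comp_clm _

/-- Truncations of `f` converge to `f` in norm, and each gives a finite-rank operator. -/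
theorem isCompactOperator_of_mem_cZero {f : EllInfty} (hf : f ∈ cZero) :
    diagonalHom f ∈ compactOps := by
  have key : Filter.Tendsto (fun N => ∑ n ∈ Finset.range N, lp.single ∞ n (f n))
      Filter.atTop (𝓝 f) := by
    refine Metric.tendsto_atTop.2 fun ε hε => ?_
    obtain ⟨N, hN⟩ := Metric.tendsto_atTop.1 hf (ε / 2) (half_pos hε)
    refine ⟨N, fun M hM => ?_⟩
    rw [dist_comm, dist_eq_norm]
    refine lt_of_le_of_lt (lp.norm_le_of_forall_le (half_pos hε).le fun k => ?_) (half_lt_self hε)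
    rw [lp.coeFn_sub, lp.coeFn_sum, Pi.sub_apply, Finset.sum_apply]
    simp only [lp.coeFn_single, Finset.sum_pi_single, Finset.mem_range]
    split_ifs with hk
    · simpa using (half_pos hε).le
    · have := hN k (by omega)
      rw [dist_zero_right] at this
      simpa using this.le
  refine isCompactOperator_of_tendsto ((diagonalHom_isometry.continuous.tendsto f).comp key)
    (Filter.Eventually.of_forall fun N => ?_)
  simp only [Function.comp, map_sum]
  have : ∀ s : Finset ℕ, (∑ n ∈ s, diagonalHom (lp.single ∞ n (f n))) ∈
      compactOperator (RingHom.id ℂ) EllTwo EllTwo :=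
    fun s => Submodule.sum_mem _ fun n _ => isCompactOperator_single n (f n)
  exact this _

theorem diagonalHom_image_cZero :
    diagonalHom '' cZero = compactOps ∩ Set.range diagonalHom := by
  ext T
  constructor
  · rintro ⟨f, hf, rfl⟩
    exact ⟨isCompactOperator_of_mem_cZero hf, f, rfl⟩
  · rintro ⟨hT, f, rfl⟩
    exact ⟨f, mem_cZero_of_isCompactOperator hT, rfl⟩

/-! ### Infinite ampliations. -/

section Ampliation

variable {H : Type*} [NormedAddCommGroup H] [InnerProductSpace ℂ H]

/-- `T` acting in each coordinate of `ℓ₂(ℕ, H)`. -/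
noncomputable def ampliationOp (T : H →L[ℂ] H) :
    lp (fun _ : ℕ => H) 2 →L[ℂ] lp (fun _ : ℕ => H) 2 :=
  lp.mapCLM 2 (fun _ => T) (norm_nonneg T) fun _ => le_rfl

@[simp]
theorem ampliationOp_apply (T : H →L[ℂ] H) (g : lp (fun _ : ℕ => H) 2) (n : ℕ) :
    ampliationOp T g n = T (g n) := by
  simp [ampliationOp]

variable (H) in
/-- The infinite ampliation `T ↦ T ⊗ 1` on `H ⊗ ℓ₂ = ℓ₂(ℕ, H)`. -/
noncomputable def ampliation [CompleteSpace H] : (H →L[ℂ] H) →⋆ₙₐ[ℂ]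
    (lp (fun _ : ℕ => H) 2 →L[ℂ] lp (fun _ : ℕ => H) 2) where
  toFun := ampliationOp
  map_zero' := ContinuousLinearMap.ext fun g => lp.ext (funext fun n => by simp)
  map_smul' c T := ContinuousLinearMap.ext fun g => lp.ext (funext fun n => by simp)
  map_mul' a b := ContinuousLinearMap.ext fun g => lp.ext (funext fun n => by simp)
  map_add' a b := ContinuousLinearMap.ext fun g => lp.ext (funext fun n => by simp)
  map_star' a := by
    refine (ContinuousLinearMap.eq_adjoint_iff _ _).2 fun x y => ?_
    rw [lp.inner_eq_tsum, lp.inner_eq_tsum]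
    refine tsum_congr fun n => ?_
    simp [ContinuousLinearMap.star_eq_adjoint, ContinuousLinearMap.adjoint_inner_left]

theorem ampliation_single [CompleteSpace H] (T : H →L[ℂ] H) (n : ℕ) (h : H) :
    ampliation H T (lp.single 2 n h) = lp.single 2 n (T h) := by
  refine lp.ext (funext fun k => ?_)
  refine (ampliationOp_apply T _ k).trans ?_
  rcases eq_or_ne k n with rfl | hk
  · simp
  · rw [lp.single_apply_ne _ _ _ hk, lp.single_apply_ne _ _ _ hk, map_zero]

/-- If `T v ≠ 0`, the copies of `v` in the different coordinates are bounded with separated images.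
-/
theorem eq_zero_of_isCompactOperator_ampliation [CompleteSpace H] {T : H →L[ℂ] H}
    (hT : IsCompactOperator (ampliation H T)) : T = 0 := by
  by_contra h
  obtain ⟨v, hv⟩ : ∃ v, T v ≠ 0 := by
    by_contra! hn
    exact h (ContinuousLinearMap.ext hn)
  refine not_isCompactOperator_of_separated (ampliation H T) (fun k => lp.single 2 k v) (C := ‖v‖)
    (fun k => by rw [lp.norm_single (by norm_num)]) (norm_pos_iff.2 hv) (fun m n hmn => ?_) hT
  rw [ampliation_single, ampliation_single]
  exact lp_single_dist_ge hmn.ne _ _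

theorem separableSpace_lp_two [TopologicalSpace.SeparableSpace H] :
    TopologicalSpace.SeparableSpace (lp (fun _ : ℕ => H) 2) := by
  have h1 : TopologicalSpace.IsSeparable
      (⋃ n : ℕ, Set.range (lp.singleContinuousLinearMap ℂ (fun _ : ℕ => H) 2 n)) :=
    .iUnion fun n => TopologicalSpace.isSeparable_range (ContinuousLinearMap.continuous _)
  have h2 := h1.span (R := ℂ)
  rw [← TopologicalSpace.isSeparable_univ_iff]
  refine h2.closure.mono fun f _ => ?_
  refine mem_closure_of_tendsto (lp.hasSum_single (by norm_num) f) (.of_forall fun s => ?_)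
  exact Submodule.sum_mem _ fun n _ => Submodule.subset_span (Set.mem_iUnion.2 ⟨n, f n, rfl⟩)

end Ampliation

/-! ### Transport of separable Hilbert spaces into `ℓ₂`. -/

theorem Orthonormal.countable_index {ι E : Type*} [NormedAddCommGroup E] [InnerProductSpace ℂ E]
    [TopologicalSpace.SeparableSpace E] {v : ι → E} (hv : Orthonormal ℂ v) : Countable ι := by
  have hd : ∀ i j, i ≠ j → 1 ≤ dist (v i) (v j) := fun i j hij => by
    have h := norm_sub_sq (𝕜 := ℂ) (v i) (v j)
    rw [hv.2 hij, hv.1 i, hv.1 j] at h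
    rw [dist_eq_norm]
    norm_num at h
    nlinarith [norm_nonneg (v i - v j)]
  have hc : (Set.univ : Set ι).Countable := by
    refine Set.PairwiseDisjoint.countable_of_isOpen (s := fun i => Metric.ball (v i) (1 / 2))
      (fun i _ j _ hij => ?_) (fun _ _ => Metric.isOpen_ball)
      fun i _ => Metric.nonempty_ball.2 (by norm_num)
    exact Metric.ball_disjoint_ball (by linarith [hd i j hij])
  exact Set.countable_univ_iff.1 hc

/-- Every separable complex Hilbert space embeds isometrically into `ℓ₂(ℕ)`. -/
theorem exists_linearIsometry_ellTwo (E : Type*) [NormedAddCommGroup E] [InnerProductSpace ℂ E]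
    [CompleteSpace E] [TopologicalSpace.SeparableSpace E] : Nonempty (E →ₗᵢ[ℂ] EllTwo) := by
  obtain ⟨w, b, -⟩ := exists_hilbertBasis ℂ E
  have : Countable w := b.orthonormal.countable_index
  obtain ⟨e, he⟩ := exists_injective_nat w
  have ho : Orthonormal ℂ fun i : w => (lp.single 2 (e i) 1 : EllTwo) := by
    refine ⟨fun i => by rw [lp.norm_single (by norm_num)]; simp, fun i j hij => ?_⟩
    refine (lp.inner_single_left _ _ _).trans ?_
    rw [lp.single_apply_ne _ _ _ (he.ne hij), inner_zero_right]
  exact ⟨ho.orthogonalFamily.linearIsometry.comp b.repr.toLinearIsometry⟩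

/-- Conjugation by an isometry, `T ↦ V T V*`. -/
noncomputable def conjIsometry {E F : Type*} [NormedAddCommGroup E] [InnerProductSpace ℂ E]
    [CompleteSpace E] [NormedAddCommGroup F] [InnerProductSpace ℂ F] [CompleteSpace F]
    (V : E →ₗᵢ[ℂ] F) : (E →L[ℂ] E) →⋆ₙₐ[ℂ] (F →L[ℂ] F) where
  toFun T := V.toContinuousLinearMap ∘L T ∘L V.toContinuousLinearMap.adjoint
  map_zero' := by simp
  map_smul' c T := by simp
  map_add' S T := by simp
  map_mul' S T := by
    have h : ∀ x, V.toContinuousLinearMap.adjoint (V x) = x := fun x =>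
      congrArg (fun T : E →L[ℂ] E => T x) V.adjoint_comp_self
    ext x
    simp [h]
  map_star' T := by
    simp [ContinuousLinearMap.star_eq_adjoint, ContinuousLinearMap.adjoint_comp,
      ContinuousLinearMap.comp_assoc]

/-- Since `V* V = 1`, compactness of `V T V*` passes back to `T`. -/
theorem adjoint_conjIsometry_apply {E F : Type*} [NormedAddCommGroup E] [InnerProductSpace ℂ E]
    [CompleteSpace E] [NormedAddCommGroup F] [InnerProductSpace ℂ F] [CompleteSpace F]
    (V : E →ₗᵢ[ℂ] F) (T : E →L[ℂ] E) :
    V.toContinuousLinearMap.adjoint ∘L conjIsometry V T ∘L V.toContinuousLinearMap = T := by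
  have h : ∀ x, V.toContinuousLinearMap.adjoint (V x) = x := fun x =>
    congrArg (fun T : E →L[ℂ] E => T x) V.adjoint_comp_self
  ext x
  simp [conjIsometry, h]

/-- A C⋆-algebra with a faithful representation on a separable Hilbert space has an isometric copy
in `B(ℓ₂)` meeting the compact operators only in zero. -/
theorem exists_copy_of_faithful_representation {A H : Type*} [NonUnitalCStarAlgebra A]
    [NormedAddCommGroup H] [InnerProductSpace ℂ H] [CompleteSpace H]
    [TopologicalSpace.SeparableSpace H] (π : A →⋆ₙₐ[ℂ] (H →L[ℂ] H))
    (hπ : Function.Injective π) :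
    ∃ φ : A →⋆ₙₐ[ℂ] BoundedOps,
      Isometry φ ∧ Set.range φ ⊆ (Set.univ \ compactOps) ∪ {0} := by
  have := separableSpace_lp_two (H := H)
  obtain ⟨V⟩ := exists_linearIsometry_ellTwo (lp (fun _ : ℕ => H) 2)
  let φ : A →⋆ₙₐ[ℂ] BoundedOps := (conjIsometry V).comp ((ampliation H).comp π)
  have key : ∀ a, φ a ∈ compactOps → a = 0 := fun a ha => by
    have hc : IsCompactOperator (ampliation H (π a)) := by
      rw [← adjoint_conjIsometry_apply V (ampliation H (π a))]
      have hφ : IsCompactOperator (φ a) := ha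
      exact (hφ.comp_clm V.toContinuousLinearMap).clm_comp V.toContinuousLinearMap.adjoint
    exact hπ (by rw [eq_zero_of_isCompactOperator_ampliation hc, map_zero])
  refine ⟨φ, NonUnitalStarAlgHom.isometry φ ((injective_iff_map_eq_zero φ).2 fun a ha => ?_), ?_⟩
  · exact key a (by rw [ha]; exact isCompactOperator_zero)
  · rintro _ ⟨a, rfl⟩
    by_cases ha : φ a ∈ compactOps
    · right
      rw [key a ha, map_zero]
      rfl
    · exact Or.inl ⟨trivial, ha⟩

/-! ### Characters of uniform algebras. -/

section Characters

variable {X : Type*} [NonUnitalNormedCommRing X] [NormedSpace ℂ X] [IsScalarTower ℂ X X]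
  [SMulCommClass ℂ X X] [CompleteSpace X]

/-- The `ℓ¹`-unitization of a commutative Banach algebra is a commutative Banach algebra. -/
noncomputable abbrev unitizationNormedCommRing : NormedCommRing (WithLp 1 (Unitization ℂ X)) where
  __ := WithLp.instUnitizationNormedRing (𝕜 := ℂ) (A := X)
  mul_comm a b := congrArg (WithLp.toLp 1) (mul_comm (WithLp.ofLp a) (WithLp.ofLp b))

theorem IsUniformAlgebra.norm_pow_toLp_inr (hX : IsUniformAlgebra X) (a : X) (n : ℕ) :
    ‖(WithLp.toLp 1 (a : Unitization ℂ X)) ^ 2 ^ n‖ = ‖a‖ ^ 2 ^ n := by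
  induction n generalizing a with
  | zero => simpa using WithLp.unitization_norm_inr (𝕜 := ℂ) a
  | succ n ih =>
    have : (WithLp.toLp 1 (a : Unitization ℂ X)) ^ 2 =
        WithLp.toLp 1 ((a * a : X) : Unitization ℂ X) := by
      rw [sq, Unitization.inr_mul]
      rfl
    rw [pow_succ' 2 n, pow_mul, this, ih, hX a, pow_mul]

/-- Gelfand's formula need only be evaluated along the exponents `2 ^ n`, where the norms of powers
are known by repeated squaring. -/
theorem IsUniformAlgebra.spectralRadius_toLp_inr (hX : IsUniformAlgebra X) (a : X) :
    spectralRadius ℂ (WithLp.toLp 1 (a : Unitization ℂ X)) = ‖a‖₊ := by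
  have h := (spectrum.pow_nnnorm_pow_one_div_tendsto_nhds_spectralRadius
    (WithLp.toLp 1 (a : Unitization ℂ X))).comp
    (tendsto_pow_atTop_atTop_of_one_lt (one_lt_two (α := ℕ)))
  refine tendsto_nhds_unique h (tendsto_const_nhds.congr fun n => ?_)
  have hn : ‖(WithLp.toLp 1 (a : Unitization ℂ X)) ^ 2 ^ n‖₊ = ‖a‖₊ ^ 2 ^ n :=
    Subtype.ext (hX.norm_pow_toLp_inr a n)
  simp only [Function.comp]
  rw [hn, ENNReal.coe_pow, ← ENNReal.rpow_natCast, ← ENNReal.rpow_mul, mul_one_div_cancel,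
    ENNReal.rpow_one]
  positivity

/-- A uniform algebra has, for every element, a norm-attaining contractive multiplicative
functional. -/
theorem IsUniformAlgebra.exists_character (hX : IsUniformAlgebra X) (a : X) :
    ∃ χ : X →ₙₐ[ℂ] ℂ, (∀ x, ‖χ x‖ ≤ ‖x‖) ∧ ‖χ a‖ = ‖a‖ := by
  let := unitizationNormedCommRing (X := X)
  have : Nontrivial (WithLp 1 (Unitization ℂ X)) :=
    (WithLp.equiv 1 (Unitization ℂ X)).nontrivial
  obtain ⟨k, hk, hka⟩ := spectrum.exists_nnnorm_eq_spectralRadius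
    (WithLp.toLp 1 (a : Unitization ℂ X))
  obtain ⟨f, hf⟩ := WeakDual.CharacterSpace.mem_spectrum_iff_exists.1 hk
  let F : WithLp 1 (Unitization ℂ X) →ₐ[ℂ] ℂ := WeakDual.CharacterSpace.toAlgHom f
  let χ : X →ₙₐ[ℂ] ℂ := (F.comp
    (WithLp.unitizationAlgEquiv (𝕜 := ℂ) (A := X) ℂ).symm.toAlgHom : Unitization ℂ X →ₙₐ[ℂ] ℂ).comp
      (Unitization.inrNonUnitalAlgHom ℂ X)
  have hχ : ∀ x, χ x = f (WithLp.toLp 1 (x : Unitization ℂ X)) := fun x => rfl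
  refine ⟨χ, fun x => ?_, ?_⟩
  · have hx : (‖χ x‖₊ : ℝ≥0∞) ≤ ‖x‖₊ := by
      rw [← hX.spectralRadius_toLp_inr x, spectralRadius]
      refine le_iSup₂ (f := fun k _ => (‖k‖₊ : ℝ≥0∞)) (χ x) ?_
      exact WeakDual.CharacterSpace.mem_spectrum_iff_exists.2 ⟨f, (hχ x).symm⟩
    exact_mod_cast hx
  · rw [hX.spectralRadius_toLp_inr] at hka
    rw [hχ, hf]
    exact congrArg NNReal.toReal (ENNReal.coe_inj.1 hka)

/-- Evaluation of a sequence of contractive multiplicative functionals. -/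
noncomputable def characterSequence (χ : ℕ → X →ₙₐ[ℂ] ℂ) (hχ : ∀ n x, ‖χ n x‖ ≤ ‖x‖) :
    X →ₙₐ[ℂ] EllInfty where
  toFun x := ⟨fun n => χ n x, memℓp_infty ⟨‖x‖, by rintro _ ⟨n, rfl⟩; exact hχ n x⟩⟩
  map_smul' c x := lp.ext (funext fun n => by simp)
  map_zero' := lp.ext (funext fun n => by simp)
  map_add' x y := lp.ext (funext fun n => map_add (χ n) x y)
  map_mul' x y := lp.ext (funext fun n => map_mul (χ n) x y)

/-- A separable uniform algebra is isometric to an algebra of bounded sequences in which every value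
is repeated infinitely often. -/
theorem IsUniformAlgebra.exists_copy [TopologicalSpace.SeparableSpace X]
    (hX : IsUniformAlgebra X) :
    ∃ φ : X →ₙₐ[ℂ] BoundedOps,
      Isometry φ ∧ Set.range φ ⊆ (Set.univ \ compactOps) ∪ {0} := by
  choose ψ hψ hψa using fun n => hX.exists_character (TopologicalSpace.denseSeq X n)
  -- The first component of `Nat.unpair` takes each value infinitely often.
  let θ := characterSequence (fun n => ψ n.unpair.1) fun n => hψ _
  have hθ : Isometry θ := by
    refine AddMonoidHomClass.isometry_of_norm θ fun x => ?_
    have hle : ∀ x, ‖θ x‖ ≤ ‖x‖ := fun x =>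
      lp.norm_le_of_forall_le (norm_nonneg x) fun n => hψ _ x
    have hc : Continuous θ := AddMonoidHomClass.continuous_of_bound θ 1 (by simpa using hle)
    refine congrFun (DenseRange.equalizer (TopologicalSpace.denseRange_denseSeq X)
      (g := fun x => ‖θ x‖) hc.norm continuous_norm (funext fun n => ?_)) x
    refine le_antisymm (hle _) ?_
    refine (hψa n).symm.trans_le ?_
    have := lp.norm_apply_le_norm (p := ∞) (by simp) (θ (TopologicalSpace.denseSeq X n))
      (Nat.pair n 0)
    simpa [θ, characterSequence] using this
  let φ : X →ₙₐ[ℂ] BoundedOps := (diagonalHom : EllInfty →ₙₐ[ℂ] BoundedOps).comp θ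
  refine ⟨φ, diagonalHom_isometry.comp hθ, ?_⟩
  rintro _ ⟨x, rfl⟩
  by_cases hx : φ x ∈ compactOps
  · right
    have h0 : Filter.Tendsto (fun n => θ x n) Filter.atTop (𝓝 0) :=
      mem_cZero_of_isCompactOperator hx
    have hθx : θ x = 0 := by
      refine lp.ext (funext fun n => ?_)
      -- Along these indices the sequence is constant, equal to `θ x n`, yet it tends to zero.
      have h1 : Filter.Tendsto (fun m => θ x (Nat.pair n.unpair.1 m)) Filter.atTop (𝓝 0) :=
        h0.comp (Filter.tendsto_atTop_mono (fun m => Nat.right_le_pair _ m) Filter.tendsto_id)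
      exact tendsto_nhds_unique (tendsto_const_nhds.congr fun m => by simp [θ, characterSequence]) h1
    show diagonalHom (θ x) = 0
    rw [hθx, map_zero]
  · exact Or.inl ⟨trivial, hx⟩

end Characters

/-! ### Norming states and faithful functionals. -/

section States

open scoped ComplexOrder

/-- A self-adjoint element whose norm lies in its spectrum is normed by a norm-one functional taking
the value one at the unit. -/
theorem exists_functional_eq_norm {U : Type*} [CStarAlgebra U] {h : U} (hsa : IsSelfAdjoint h)
    (hspec : (‖h‖ : ℂ) ∈ spectrum ℂ h) :
    ∃ g : StrongDual ℂ U, g 1 = 1 ∧ ‖g‖ ≤ 1 ∧ g h = ‖h‖ := by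
  have : IsStarNormal h := hsa.isStarNormal
  have : Nontrivial U := by
    by_contra hn
    rw [not_nontrivial_iff_subsingleton] at hn
    simp [spectrum.of_subsingleton] at hspec
  -- `S` is commutative and has the same spectrum for `h`, so a character of `S` takes the value
  -- `‖h‖`; Hahn–Banach extends it.
  let S := StarAlgebra.elemental ℂ h
  let h' : S := ⟨h, StarAlgebra.elemental.self_mem ℂ h⟩
  have hspec' : (‖h‖ : ℂ) ∈ spectrum ℂ h' := by
    rwa [StarSubalgebra.spectrum_eq (hS := StarAlgebra.elemental.isClosed ℂ h)]
  obtain ⟨χ, hχ⟩ := WeakDual.CharacterSpace.mem_spectrum_iff_exists.1 hspec'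
  obtain ⟨g, hg, hn⟩ := exists_extension_norm_eq S.toSubalgebra.toSubmodule
    (WeakDual.toStrongDual (χ : WeakDual ℂ S))
  refine ⟨g, ?_, ?_, ?_⟩
  · exact (hg (1 : S)).trans (map_one χ)
  · rw [hn]
    exact (WeakDual.CharacterSpace.norm_le_norm_one χ).trans_eq norm_one
  · exact (hg h').trans hχ

/-- Shifting `a` by `it` raises the squared norm by at most `t ^ 2`, while the squared imaginary
part of the value gains a term linear in `t`, which is thus bounded above for all real `t`. -/
theorem im_eq_zero_of_isSelfAdjoint {U : Type*} [CStarAlgebra U] {g : StrongDual ℂ U} (h1 : g 1 = 1)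
    (hg : ‖g‖ ≤ 1) {a : U} (ha : IsSelfAdjoint a) : (g a).im = 0 := by
  have : Nontrivial U := by
    by_contra hn
    rw [not_nontrivial_iff_subsingleton] at hn
    rw [Subsingleton.elim (1 : U) 0, map_zero] at h1
    exact zero_ne_one h1
  have key : ∀ t : ℝ, 2 * t * (g a).im ≤ ‖a‖ ^ 2 := fun t => by
    have e1 : star (a + (t * Complex.I : ℂ) • (1 : U)) * (a + (t * Complex.I : ℂ) • (1 : U)) =
        a * a + ((t ^ 2 : ℝ) : ℂ) • (1 : U) := by
      have hs : star (t * Complex.I : ℂ) = -(t * Complex.I) := by simp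
      have h2 : -((t * Complex.I : ℂ) * (t * Complex.I)) = ((t ^ 2 : ℝ) : ℂ) := by
        push_cast
        linear_combination (-(t : ℂ) ^ 2) * Complex.I_sq
      rw [← h2, star_add, star_smul, hs, ha.star_eq, star_one]
      simp only [add_mul, mul_add, smul_mul_assoc, mul_smul_comm, one_mul, mul_one]
      module
    have e2 : ‖a + (t * Complex.I : ℂ) • (1 : U)‖ ^ 2 ≤ ‖a‖ ^ 2 + t ^ 2 := by
      rw [sq, ← CStarRing.norm_star_mul_self, e1]
      refine (norm_add_le _ _).trans (add_le_add ((norm_mul_le _ _).trans_eq (sq _).symm) ?_)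
      rw [norm_smul, norm_one, mul_one, Complex.norm_real, Real.norm_of_nonneg (sq_nonneg t)]
    have e3 : ‖g (a + (t * Complex.I : ℂ) • (1 : U))‖ ≤ ‖a + (t * Complex.I : ℂ) • (1 : U)‖ :=
      (g.le_of_opNorm_le hg _).trans_eq (one_mul _)
    have e4 := Complex.abs_im_le_norm (g (a + (t * Complex.I : ℂ) • (1 : U)))
    have e5 : (g (a + (t * Complex.I : ℂ) • (1 : U))).im = (g a).im + t := by
      simp [h1]
    rw [e5] at e4
    have e6 : ((g a).im + t) ^ 2 ≤ ‖a + (t * Complex.I : ℂ) • (1 : U)‖ ^ 2 :=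
      sq_le_sq.2 ((e4.trans e3).trans (le_abs_self _))
    nlinarith [sq_nonneg (g a).im]
  by_contra hne
  have := key ((‖a‖ ^ 2 + 1) / (2 * (g a).im))
  rw [show 2 * ((‖a‖ ^ 2 + 1) / (2 * (g a).im)) * (g a).im = ‖a‖ ^ 2 + 1 by field_simp] at this
  linarith

/-- A contractive functional taking the value one at the unit is positive. -/
theorem nonneg_of_norm_le_one {U : Type*} [CStarAlgebra U] {g : StrongDual ℂ U} (h1 : g 1 = 1)
    (hg : ‖g‖ ≤ 1) (b : U) : 0 ≤ g (star b * b) := by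
  let _ : PartialOrder U := CStarAlgebra.spectralOrder U
  have _ : StarOrderedRing U := CStarAlgebra.spectralOrderedRing U
  set a := star b * b with ha
  have ha0 : 0 ≤ a := star_mul_self_nonneg b
  have hsa : IsSelfAdjoint a := .star_mul_self b
  have hle : a ≤ algebraMap ℝ U ‖a‖ := hsa.le_algebraMap_norm_self
  -- From `0 ≤ ‖a‖ - a ≤ ‖a‖`; hence `g a` lies in the disc of radius `‖a‖` about `‖a‖`.
  have hn : ‖algebraMap ℝ U ‖a‖ - a‖ ≤ ‖a‖ := by
    refine (CStarAlgebra.norm_le_norm_of_nonneg_of_le (sub_nonneg.2 hle)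
      (sub_le_self _ ha0)).trans ?_
    rcases subsingleton_or_nontrivial U with hU | hU
    · simp [Subsingleton.elim (algebraMap ℝ U ‖a‖) 0]
    · simp [norm_algebraMap']
  have hga : g (algebraMap ℝ U ‖a‖ - a) = ‖a‖ - g a := by
    rw [map_sub, Algebra.algebraMap_eq_smul_one, ← Complex.coe_smul, map_smul, h1, smul_eq_mul,
      mul_one]
  have h2 : ‖(‖a‖ : ℂ) - g a‖ ≤ ‖a‖ := by
    rw [← hga]
    exact ((g.le_of_opNorm_le hg _).trans_eq (one_mul _)).trans hn
  have h3 := (Complex.re_le_norm _).trans h2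
  rw [Complex.sub_re, Complex.ofReal_re] at h3
  exact Complex.nonneg_iff.2 ⟨by linarith, (im_eq_zero_of_isSelfAdjoint h1 hg hsa).symm⟩

variable {A : Type*} [NonUnitalCStarAlgebra A]

theorem exists_positive_functional [PartialOrder A] [StarOrderedRing A] (x : A) :
    ∃ f : A →ₚ[ℂ] ℂ, (∀ a, ‖f a‖ ≤ ‖a‖) ∧ f (star x * x) = (‖x‖ : ℂ) ^ 2 := by
  let h : Unitization ℂ A := star (x : Unitization ℂ A) * x
  have hsa : IsSelfAdjoint h := .star_mul_self _
  have hnorm : ‖h‖ = ‖x‖ ^ 2 := by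
    rw [CStarRing.norm_star_mul_self, Unitization.norm_inr, sq]
  have hspec : (‖h‖ : ℂ) ∈ spectrum ℂ h := by
    let _ : PartialOrder (Unitization ℂ A) := CStarAlgebra.spectralOrder _
    have _ : StarOrderedRing (Unitization ℂ A) := CStarAlgebra.spectralOrderedRing _
    have := CStarAlgebra.norm_mem_spectrum_of_nonneg (a := h) (star_mul_self_nonneg _)
    exact (spectrum.algebraMap_mem_iff ℂ (R := ℝ)).2 this
  obtain ⟨g, hg1, hg, hgh⟩ := exists_functional_eq_norm hsa hspec
  let f₀ : A →ₗ[ℂ] ℂ := g.toLinearMap.comp (Unitization.inrHom ℂ ℂ A)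
  have hf₀ : ∀ a, f₀ a = g (a : Unitization ℂ A) := fun a => rfl
  refine ⟨PositiveLinearMap.mk₀ f₀ fun a ha => ?_, fun a => ?_, ?_⟩
  · obtain ⟨b, rfl⟩ := CStarAlgebra.nonneg_iff_eq_star_mul_self.1 ha
    rw [hf₀, Unitization.inr_mul, Unitization.inr_star]
    exact nonneg_of_norm_le_one hg1 hg _
  · refine (g.le_of_opNorm_le hg _).trans_eq ?_
    rw [one_mul]
    exact Unitization.norm_inr (𝕜 := ℂ) a
  · refine (congrArg g ?_).trans (hgh.trans ?_)
    · simp [h]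
    · rw [hnorm]
      push_cast
      rfl

/-- A separable C⋆-algebra has a faithful positive functional. -/
theorem exists_faithful_positive_functional [PartialOrder A] [StarOrderedRing A]
    [TopologicalSpace.SeparableSpace A] :
    ∃ f : A →ₚ[ℂ] ℂ, ∀ x, f (star x * x) = 0 → x = 0 := by
  choose s hs hsx using fun n => exists_positive_functional (TopologicalSpace.denseSeq A n)
  have hsum : ∀ a, Summable fun n => (1 / 2 : ℂ) ^ n * s n a := fun a => by
    refine Summable.of_norm_bounded (g := fun n => (1 / 2 : ℝ) ^ n * ‖a‖)
      (summable_geometric_two.mul_right _) fun n => ?_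
    rw [norm_mul, norm_pow]
    have : ‖(1 / 2 : ℂ)‖ = 1 / 2 := by norm_num
    rw [this]
    gcongr
    exact hs n a
  have hpos : ∀ a, 0 ≤ a → ∀ n, 0 ≤ (1 / 2 : ℂ) ^ n * s n a := fun a ha n =>
    mul_nonneg (pow_nonneg (by norm_num [Complex.nonneg_iff]) n) ((s n).map_nonneg ha)
  let f₀ : A →ₗ[ℂ] ℂ :=
    { toFun := fun a => ∑' n, (1 / 2 : ℂ) ^ n * s n a
      map_add' := fun a b => by
        simp only [map_add, mul_add]
        exact (hsum a).tsum_add (hsum b)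
      map_smul' := fun c a => by
        simp only [map_smul, smul_eq_mul, RingHom.id_apply, mul_left_comm _ c]
        exact tsum_mul_left }
  refine ⟨PositiveLinearMap.mk₀ f₀ fun a ha => tsum_nonneg (hpos a ha), fun x hx => ?_⟩
  have h0 : ∀ n, s n (star x * x) = 0 := fun n => by
    have hz : HasSum (fun n => (1 / 2 : ℂ) ^ n * s n (star x * x)) 0 := by
      have := (hsum (star x * x)).hasSum
      rwa [show ∑' n, (1 / 2 : ℂ) ^ n * s n (star x * x) = 0 from hx] at this
    have := congrFun ((hasSum_zero_iff_of_nonneg (hpos _ (star_mul_self_nonneg x))).1 hz) n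
    simpa using this
  -- For `y` in the dense sequence, some `s n` attains `‖y‖ ^ 2` at `star y * y` and vanishes at
  -- `star x * x`. Both sides are continuous, so `y = x` is allowed.
  have key : ∀ y : A, ‖y‖ ^ 2 ≤ ‖star y * y - star x * x‖ := fun y => by
    refine (TopologicalSpace.denseRange_denseSeq A).induction_on
      (p := fun y => ‖y‖ ^ 2 ≤ ‖star y * y - star x * x‖) y ?_ fun n => ?_
    · exact isClosed_le (by fun_prop) (by fun_prop)
    · refine le_trans (le_of_eq ?_) (hs n _)
      rw [map_sub, h0, sub_zero, hsx]
      simp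
  have := key x
  rw [sub_self, norm_zero] at this
  simpa using le_antisymm this (sq_nonneg _)

end States

/-! ### The GNS representation of the multiplier algebra. -/

section MultiplierRepresentation

open scoped ComplexOrder InnerProductSpace
open UniformSpace

variable {A : Type*} [NonUnitalCStarAlgebra A]

/-- This adjoint relation for the pairing `star a * b` makes the GNS action a ⋆-homomorphism. -/
theorem DoubleCentralizer.star_mul_star_fst (m : 𝓜(ℂ, A)) (a b : A) :
    star a * (star m).fst b = star (m.fst a) * b := by
  rw [DoubleCentralizer.star_fst, ← star_mul, m.central, star_mul, star_star]

variable [PartialOrder A] [StarOrderedRing A] (f : A →ₚ[ℂ] ℂ)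

/-- In the C⋆-algebra `𝓜(ℂ, A)`, `‖m‖ ^ 2 - star m * m` has the form `star n * n`; sandwiching it
between `star a` and `a` gives a positive element of `A`. -/
theorem PositiveLinearMap.map_star_fst_mul_fst_le (m : 𝓜(ℂ, A)) (a : A) :
    f (star (m.fst a) * m.fst a) ≤ (‖m‖ : ℂ) ^ 2 * f (star a * a) := by
  obtain ⟨n, hn⟩ : ∃ n : 𝓜(ℂ, A), algebraMap ℝ 𝓜(ℂ, A) (‖m‖ ^ 2) - star m * m = star n * n := by
    let _ : PartialOrder 𝓜(ℂ, A) := CStarAlgebra.spectralOrder _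
    have _ : StarOrderedRing 𝓜(ℂ, A) := CStarAlgebra.spectralOrderedRing _
    refine CStarAlgebra.nonneg_iff_eq_star_mul_self.1 (sub_nonneg.2 ?_)
    rw [sq, ← CStarRing.norm_star_mul_self]
    exact (IsSelfAdjoint.star_mul_self m).le_algebraMap_norm_self
  have h1 : ((‖m‖ : ℂ) ^ 2) • (star a * a) - star (m.fst a) * m.fst a =
      star (n.fst a) * n.fst a := by
    have := congrArg (fun k : 𝓜(ℂ, A) => star a * k.fst a) hn
    simp only [DoubleCentralizer.sub_fst, DoubleCentralizer.mul_fst, sub_apply,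
      mul_apply_eq_comp, mul_sub, DoubleCentralizer.star_mul_star_fst,
      Algebra.algebraMap_eq_smul_one] at this
    rw [← this, ← Complex.coe_smul, DoubleCentralizer.smul_fst, DoubleCentralizer.one_fst]
    simp [mul_smul_comm]
  have h2 := f.map_nonneg (star_mul_self_nonneg (n.fst a))
  rw [← h1, map_sub, map_smul, smul_eq_mul] at h2
  exact sub_nonneg.1 h2

/-- A multiplier acting on the pre-Hilbert space of a positive functional. -/
noncomputable def multiplierPreGNS (m : 𝓜(ℂ, A)) : f.PreGNS →L[ℂ] f.PreGNS :=
  (f.toPreGNS.toLinearMap ∘ₗ m.fst.toLinearMap ∘ₗ f.ofPreGNS.toLinearMap).mkContinuous ‖m‖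
    fun x => by
      rw [← sq_le_sq₀ (by positivity) (by positivity), mul_pow, ← Complex.real_le_real]
      push_cast
      rw [f.preGNS_norm_sq, f.preGNS_norm_sq]
      exact f.map_star_fst_mul_fst_le m (f.ofPreGNS x)

variable {f} in
theorem PositiveLinearMap.gns_ext {S T : f.GNS →L[ℂ] f.GNS} (h : ∀ x : f.PreGNS, S x = T x) :
    S = T :=
  ContinuousLinearMap.ext fun x =>
    Completion.induction_on x (isClosed_eq S.continuous T.continuous) h

theorem multiplierPreGNS_completion_coe (m : 𝓜(ℂ, A)) (x : f.PreGNS) :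
    (multiplierPreGNS f m).completion x = (multiplierPreGNS f m x : f.PreGNS) :=
  ContinuousLinearMap.completion_apply_coe _ _

/-- The representation of the multiplier algebra on the GNS space of a positive functional. -/
noncomputable def multiplierGNS : 𝓜(ℂ, A) →⋆ₙₐ[ℂ] (f.GNS →L[ℂ] f.GNS) where
  toFun m := (multiplierPreGNS f m).completion
  map_smul' c m := PositiveLinearMap.gns_ext fun x => by
    rw [MonoidHom.id_apply, smul_apply, multiplierPreGNS_completion_coe,
      multiplierPreGNS_completion_coe, ← Completion.coe_smul]
    rfl
  map_zero' := PositiveLinearMap.gns_ext fun x => by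
    rw [multiplierPreGNS_completion_coe, zero_apply, ← Completion.coe_zero]
    rfl
  map_add' m n := PositiveLinearMap.gns_ext fun x => by
    rw [add_apply, multiplierPreGNS_completion_coe, multiplierPreGNS_completion_coe,
      multiplierPreGNS_completion_coe, ← Completion.coe_add]
    rfl
  map_mul' m n := PositiveLinearMap.gns_ext fun x => by
    rw [mul_apply_eq_comp, multiplierPreGNS_completion_coe,
      multiplierPreGNS_completion_coe, multiplierPreGNS_completion_coe]
    rfl
  map_star' m := by
    refine (ContinuousLinearMap.eq_adjoint_iff _ _).2 fun x y => ?_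
    induction x, y using Completion.induction_on₂ with
    | hp => apply isClosed_eq <;> fun_prop
    | ih x y =>
      rw [multiplierPreGNS_completion_coe, multiplierPreGNS_completion_coe, Completion.inner_coe,
        Completion.inner_coe, f.preGNS_inner_def, f.preGNS_inner_def]
      have := DoubleCentralizer.star_mul_star_fst (star m) (f.ofPreGNS x) (f.ofPreGNS y)
      rw [star_star] at this
      exact congrArg f this.symm

theorem multiplierGNS_apply_coe (m : 𝓜(ℂ, A)) (x : f.PreGNS) :
    multiplierGNS f m x = (f.toPreGNS (m.fst (f.ofPreGNS x)) : f.PreGNS) :=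
  ContinuousLinearMap.completion_apply_coe _ _

theorem multiplierGNS_injective (hf : ∀ x, f (star x * x) = 0 → x = 0) :
    Function.Injective (multiplierGNS f) := by
  refine (injective_iff_map_eq_zero _).2 fun m hm => ?_
  have hfst : m.fst = 0 := ContinuousLinearMap.ext fun a => by
    have h := multiplierGNS_apply_coe f m (f.toPreGNS a)
    rw [hm, zero_apply] at h
    have h1 := congrArg norm h
    rw [norm_zero, Completion.norm_coe] at h1
    refine hf _ ?_
    have h2 := f.preGNS_norm_sq (f.toPreGNS (m.fst a))
    rw [show ‖f.toPreGNS (m.fst a)‖ = 0 from h1.symm] at h2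
    simpa using h2.symm
  rw [← norm_eq_zero, ← DoubleCentralizer.norm_fst, hfst, norm_zero]

/-- Boundedness of `f` makes the dense-range map from `A` to the GNS space continuous. -/
theorem separableSpace_gns [TopologicalSpace.SeparableSpace A] :
    TopologicalSpace.SeparableSpace f.GNS := by
  obtain ⟨C, hC⟩ := f.exists_norm_apply_le
  have hcont : Continuous f.toPreGNS := by
    refine AddMonoidHomClass.continuous_of_bound f.toPreGNS (√C) fun a => ?_
    rw [← sq_le_sq₀ (by positivity) (by positivity), mul_pow, Real.sq_sqrt C.coe_nonneg]
    have h1 := congrArg norm (f.preGNS_norm_sq (f.toPreGNS a))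
    rw [norm_pow, Complex.norm_real, norm_norm] at h1
    rw [h1]
    refine (hC _).trans_eq ?_
    rw [f.ofPreGNS_toPreGNS, CStarRing.norm_star_mul_self, sq]
  have hd : DenseRange ((↑) ∘ f.toPreGNS : A → f.GNS) :=
    Completion.denseRange_coe.comp f.toPreGNS.surjective.denseRange
      (Completion.continuous_coe _)
  exact hd.separableSpace ((Completion.continuous_coe _).comp hcont)

end MultiplierRepresentation

/-! ### Copies inside `B(ℓ₂)`. -/

/-- The multiplier algebra of a separable C⋆-algebra has an isometric copy in `B(ℓ₂)` meeting the
compact operators only in zero. -/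
theorem exists_copy_multiplierAlgebra (A : Type*) [NonUnitalCStarAlgebra A]
    [TopologicalSpace.SeparableSpace A] :
    ∃ φ : 𝓜(ℂ, A) →⋆ₙₐ[ℂ] BoundedOps,
      Isometry φ ∧ Set.range φ ⊆ (Set.univ \ compactOps) ∪ {0} := by
  let _ : PartialOrder A := CStarAlgebra.spectralOrder A
  have _ : StarOrderedRing A := CStarAlgebra.spectralOrderedRing A
  obtain ⟨f, hf⟩ := exists_faithful_positive_functional (A := A)
  have := separableSpace_gns f
  exact exists_copy_of_faithful_representation (multiplierGNS f) (multiplierGNS_injective f hf)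

/-- A separable C⋆-algebra has an isometric copy in `B(ℓ₂)` meeting the compact operators only in
zero. No condition on its compact elements is needed: infinite ampliations are never compact. -/
theorem exists_copy_separable (A : Type*) [NonUnitalCStarAlgebra A]
    [TopologicalSpace.SeparableSpace A] :
    ∃ φ : A →⋆ₙₐ[ℂ] BoundedOps,
      Isometry φ ∧ Set.range φ ⊆ (Set.univ \ compactOps) ∪ {0} := by
  obtain ⟨φ, hφ, hr⟩ := exists_copy_multiplierAlgebra A
  refine ⟨φ.comp (DoubleCentralizer.coeHom (𝕜 := ℂ)), hφ.comp ?_, ?_⟩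
  · refine NonUnitalStarAlgHom.isometry (DoubleCentralizer.coeHom (𝕜 := ℂ) (A := A))
      ((injective_iff_map_eq_zero _).2 fun a ha => ?_)
    -- Left multiplication by `a` is zero, so `a * star a = 0`.
    have := congrArg (fun m : 𝓜(ℂ, A) => m.fst (star a)) ha
    exact CStarRing.mul_star_self_eq_zero_iff a |>.1 this
  · rintro _ ⟨a, rfl⟩
    exact hr ⟨_, rfl⟩

theorem mainTheorem8 :
    -- (1), uniform algebras: an isometric copy as an algebra
    (∀ (X : Type*) [NonUnitalNormedCommRing X] [NormedSpace ℂ X] [IsScalarTower ℂ X X]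
        [SMulCommClass ℂ X X] [CompleteSpace X] [TopologicalSpace.SeparableSpace X],
        IsUniformAlgebra X → compactElements X = {0} →
        ∃ φ : X →ₙₐ[ℂ] BoundedOps,
          Isometry φ ∧ Set.range φ ⊆ (Set.univ \ compactOps) ∪ {0}) ∧
    -- (1), abelian C⋆-algebras: an isometric copy as a C⋆-algebra
    (∀ (X : Type*) [NonUnitalCommCStarAlgebra X] [TopologicalSpace.SeparableSpace X],
        compactElements X = {0} →
        ∃ φ : X →⋆ₙₐ[ℂ] BoundedOps,
          Isometry φ ∧ Set.range φ ⊆ (Set.univ \ compactOps) ∪ {0}) ∧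
    -- (2), multiplier algebras of separable non-unital C⋆-algebras
    (∀ (A : Type*) [NonUnitalCStarAlgebra A] [TopologicalSpace.SeparableSpace A],
        ¬ HasUnit A → compactElements A = {0} →
        ∃ φ : 𝓜(ℂ, A) →⋆ₙₐ[ℂ] BoundedOps,
          Isometry φ ∧ Set.range φ ⊆ (Set.univ \ compactOps) ∪ {0}) ∧
    -- the diagonal embedding of `ℓ∞` in `B(ℓ₂)`
    (∃ Φ : EllInfty →⋆ₐ[ℂ] BoundedOps,
        (∀ (f : EllInfty) (g : EllTwo) (n : ℕ), Φ f g n = f n * g n) ∧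
        Isometry Φ ∧ Φ '' cZero = compactOps ∩ Set.range Φ) :=
  ⟨fun _ _ _ _ _ _ _ hX _ => hX.exists_copy, fun X _ _ _ => exists_copy_separable X,
    fun A _ _ _ _ => exists_copy_multiplierAlgebra A,
    diagonalHom, diagonalHom_apply, diagonalHom_isometry, diagonalHom_image_cZero⟩
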